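/- **Setting.** A diffeological space is a set with a diffeology; subsets, quotients, products, disjoint unions and spaces of smooth maps carry the subset, quotient, product, disjoint union and functional diffeologies. A diffeological vector pseudo-bundle $\pi:V\to X$ is a smooth surjection whose fibres are real vector spaces such that fibrewise addition $V\times_XV\to V$, scalar multiplication $\mathbb R\times V\to V$ and the zero section are smooth; $C^\infty(X,V)$ denotes its smooth sections. A $1$-form $\omega\in\Omega^1(X)$ assigns to each plot $p$ a smooth $1$-form $\omega(p)$ on its domain with $\omega(p\circ F)=F^*(\omega(p))$ for smooth $F$; $\Omega^1_x(X)$ is the subspace of forms with $\omega(p)(0)=0$ for all plots $p$ with $p(0)=x$; and $\Lambda^1(X)=(X\times\Omega^1(X))/\bigcup_x(\{x\}\times\Omega^1_x(X))$, with fibres $\Lambda^1_x(X)=\Omega^1(X)/\Omega^1_x(X)$. A smooth map $\varphi:A\to B$ induces pullbacks $\varphi^*:\Lambda^1_{\varphi(a)}(B)\to\Lambda^1_a(A)$. A connection on $V$ (with finite-dimensional fibres) is a smooth linear operator $\nabla:C^\infty(X,V)\to C^\infty(X,\Lambda^1(X)\otimes V)$ with $\nabla(hs)=dh\otimes s+h\nabla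 s$ for $h\in C^\infty(X,\mathbb R)$. A pseudo-metric on $V$ is a smooth section $g$ of $V^*\otimes V^*$ such that each $g(x)$ is a symmetric positive semidefinite form on $V_x$ of rank $\dim (V_x)^*$, where $(V_x)^*$ is the space of smooth linear functionals. An operator $\nabla$ from $C^\infty(X,V)$ to sections of $\Lambda^1(X)\otimes V$ is compatible with $g$ if for all $s,t\in C^\infty(X,V)$ the function $g(s,t)$ is smooth and $d(g(s,t))=g(\nabla s,t)+g(s,\nabla t)$ as sections of $\Lambda^1(X)$, where $g(\omega\otimes s,t)=g(s,\omega\otimes t)=g(s,t)\,\omega$. **Gluing.** Let $\pi_1:V_1\to X_1$ and $\pi_2:V_2\to X_2$ be diffeological vector pseudo-bundles with finite-dimensional fibres, let $Y\subseteq X_1$, let $f:Y\to X_2$ be a diffeomorphism onto its image, and let $\tilde f:\pi_1^{-1}(Y)\to\pi_2^{-1}(f(Y))$ be a diffeomorphism that lifts $f$ and is linear on each fibre. Let $X_1\cup_fX_2=(X_1\sqcup X_2)/(y\sim f(y))$ and $V_1\cup_{\tilde f}V_2=(V_1\sqcup V_2)/(v\sim\tilde f(v))$ be the glued spaces with the quotient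 diffeologies. As a set $X_1\cup_fX_2$ is the disjoint union of $X_1\setminus Y$ and $X_2$, and $V_1\cup_{\tilde f}V_2\to X_1\cup_fX_2$ has the fibres of $V_1$ over $X_1\setminus Y$ and those of $V_2$ over $X_2$. Each $s\in C^\infty(X_1\cup_fX_2,V_1\cup_{\tilde f}V_2)$ is $s=s_1\cup s_2$ for a unique pair $s_i\in C^\infty(X_i,V_i)$ that is compatible, i.e. $\tilde f\circ s_1=s_2\circ f$ on $Y$. Let $i:Y\to X_1$ be the inclusion, and let $\tilde\rho_1,\tilde\rho_2$ be the pullbacks from fibres of $\Lambda^1(X_1\cup_fX_2)$ to fibres of $\Lambda^1(X_1)$ and $\Lambda^1(X_2)$ along the canonical maps $X_1\to X_1\cup_fX_2$ and $X_2\to X_1\cup_fX_2$. **Hypotheses.** 1. $\mathcal D_1^\Omega=\mathcal D_2^\Omega$: the pushforwards to $\Omega^1(Y)$ of the diffeologies of $\Omega^1(X_1)$ and $\Omega^1(X_2)$ by $i^*$ and $f^*$ coincide. 2. $\nabla^1$, $\nabla^2$ are connections on $V_1$, $V_2$ that are compatible with the gluing: for all compatible $s_1,s_2$ and all $y\in Y$,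 $(i^*\otimes\tilde f)\big((\nabla^1s_1)(y)\big)=(f^*\otimes\mathrm{Id})\big((\nabla^2s_2)(f(y))\big)$ in $\Lambda^1_y(Y)\otimes (V_2)_{f(y)}$. 3. $g_1$, $g_2$ are pseudo-metrics on $V_1$, $V_2$ with $g_1(y)(v,w)=g_2(f(y))(\tilde f(v),\tilde f(w))$ for all $y\in Y$ and $v,w\in(V_1)_y$. 4. $\nabla^1$ is compatible with $g_1$ and $\nabla^2$ is compatible with $g_2$. **Induced objects.** The induced pseudo-metric $\tilde g$ is $g_1$ over $X_1\setminus Y$ and $g_2$ over $X_2$. The induced operator $\nabla^\cup$ is defined, for $s=s_1\cup s_2$, by $$(\nabla^\cup s)(x)=\begin{cases}(\tilde\rho_1^{-1}\otimes\mathrm{Id})\big((\nabla^1s_1)(x)\big)&x\in X_1\setminus Y,\\ \big((\tilde\rho_1\oplus\tilde\rho_2)^{-1}\otimes\mathrm{Id}\big)\big((\mathrm{Id}\otimes\tilde f)((\nabla^1s_1)(y))\oplus(\nabla^2s_2)(x)\big)&x=f(y)\in f(Y),\\ (\tilde\rho_2^{-1}\otimes\mathrm{Id})\big((\nabla^2s_2)(x)\big)&x\in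 X_2\setminus f(Y).\end{cases}$$ The maps $\tilde\rho_1$, $\tilde\rho_1\oplus\tilde\rho_2$, $\tilde\rho_2$ that are inverted here are injective on the fibres in question, and the symbol $(\cdot)^{-1}$ stands for a linear left inverse, fixed at each point; where the vector to which it is applied has a preimage, the value is that preimage. **Theorem.** Under these hypotheses the induced connection $\nabla^\cup$ on $V_1\cup_{\tilde f}V_2$ is compatible with the induced pseudo-metric $\tilde g$: for all $s,t\in C^\infty(X_1\cup_fX_2,V_1\cup_{\tilde f}V_2)$ the function $\tilde g(s,t)$ is smooth and $$d(\tilde g(s,t))=\tilde g(\nabla^\cup s,t)+\tilde g(s,\nabla^\cup t).$$ -/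

import Mathlib

open Diffeology
open scoped TensorProduct ContDiff

universe u u₁ u₂ v w

namespace DiffConn

noncomputable section

/-- The Euclidean space `ℝⁿ`, the domain of the plots. -/
abbrev Euc (n : ℕ) := EuclideanSpace ℝ (Fin n)

/-! ### Basic constructions of diffeologies -/

/-- The pullback diffeology along `φ` (the subset diffeology when `φ` is an inclusion). -/
@[reducible] def inducedDiffeology {A : Type u} {B : Type v} [DiffeologicalSpace B] (φ : A → B) :
    DiffeologicalSpace A where
  plots n := {p | IsPlot (φ ∘ p)}
  constant_plots _ := isPlot_const
  plot_reparam hp hf := by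
    exact isPlot_reparam (X := B) hp hf
  locality hp := DiffeologicalSpace.locality fun x => by
    obtain ⟨s, hs, hx, h⟩ := hp x
    exact ⟨s, hs, hx, fun hf hf' => h hf hf'⟩

/-- Subsets carry the subset diffeology. -/
instance subtypeDiffeology {A : Type u} [DiffeologicalSpace A] (P : A → Prop) :
    DiffeologicalSpace {a // P a} := inducedDiffeology Subtype.val

/-- The product diffeology. -/
instance prodDiffeology {A : Type u} {B : Type v} [DiffeologicalSpace A] [DiffeologicalSpace B] :
    DiffeologicalSpace (A × B) :=
  inducedDiffeology Prod.fst ⊓ inducedDiffeology Prod.snd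

/-- The disjoint union diffeology: the smallest one for which both injections are smooth. -/
instance sumDiffeology {A : Type u} {B : Type v} [DiffeologicalSpace A] [DiffeologicalSpace B] :
    DiffeologicalSpace (A ⊕ B) :=
  DiffeologicalSpace.generateFrom
    {q | (∃ p : Euc q.1 → A, IsPlot p ∧ q.2 = Sum.inl ∘ p) ∨
         (∃ p : Euc q.1 → B, IsPlot p ∧ q.2 = Sum.inr ∘ p)}

/-- The pushforward diffeology along `φ`: the smallest one for which `φ` is smooth. -/
@[reducible] def pushforwardDiffeology {A : Type u} {B : Type v} [DiffeologicalSpace A]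
    (φ : A → B) : DiffeologicalSpace B :=
  DiffeologicalSpace.generateFrom {q | ∃ p : Euc q.1 → A, IsPlot p ∧ q.2 = φ ∘ p}

/-- `φ` is a diffeomorphism of its domain with its image (which carries the subset diffeology):
it is injective, it is smooth, and its inverse on the image is smooth. -/
def IsDiffeoOntoImage {A : Type u} {B : Type v} [DiffeologicalSpace A] [DiffeologicalSpace B]
    (φ : A → B) : Prop :=
  Function.Injective φ ∧ DSmooth φ ∧
    ∃ ψ : Set.range φ → A, DSmooth ψ ∧ ∀ a, ψ ⟨φ a, Set.mem_range_self a⟩ = a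

/-- Around a point of an open set `s` the identity agrees with a smooth map with values in `s`. -/
theorem exists_smooth_cutoff {n : ℕ} {s : Set (Euc n)} (hs : IsOpen s) {x : Euc n} (hx : x ∈ s) :
    ∃ b : Euc n → Euc n, ContDiff ℝ ∞ b ∧ (∀ z, b z ∈ s) ∧ ∀ᶠ z in nhds x, b z = z := by
  obtain ⟨r, hr, hrs⟩ := Metric.isOpen_iff.mp hs x hx
  let χ : ContDiffBump x := ⟨r / 2, r, by positivity, by linarith⟩
  refine ⟨fun z => x + χ z • (z - x), ?_, ?_, ?_⟩
  · exact contDiff_const.add (χ.contDiff.smul (contDiff_id.sub contDiff_const))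
  · intro z
    apply hrs
    rw [Metric.mem_ball, dist_eq_norm, add_sub_cancel_left, norm_smul]
    by_cases hz : z ∈ Metric.ball x r
    · rw [Metric.mem_ball, dist_eq_norm] at hz
      have h1 : ‖χ z‖ ≤ 1 := by
        rw [Real.norm_of_nonneg χ.nonneg]; exact χ.le_one
      nlinarith [norm_nonneg (z - x), norm_nonneg (χ z)]
    · have : χ z = 0 := χ.zero_of_le_dist (by simpa [Metric.mem_ball] using hz)
      simpa [this] using hr
  · filter_upwards [χ.eventuallyEq_one] with z hz
    simp only [hz, Pi.one_apply, one_smul]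
    abel

/-- A plot of a generated diffeology is locally constant or locally a generator, if the set of
generators is stable under smooth reparametrisation. -/
theorem isPlot_generateFrom {A : Type u} {g : Set ((n : ℕ) × (Euc n → A))}
    (hg : ∀ (n m : ℕ) (p : Euc n → A) (F : Euc m → Euc n), ContDiff ℝ ∞ F →
      (⟨n, p⟩ : (n : ℕ) × (Euc n → A)) ∈ g → (⟨m, p ∘ F⟩ : (n : ℕ) × (Euc n → A)) ∈ g)
    {n : ℕ} {q : Euc n → A} (hq : @IsPlot A (DiffeologicalSpace.generateFrom g) n q) (x : Euc n) :
    ∃ s : Set (Euc n), IsOpen s ∧ x ∈ s ∧ ((∃ c, ∀ z ∈ s, q z = c) ∨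
      ∃ p : Euc n → A, (⟨n, p⟩ : (n : ℕ) × (Euc n → A)) ∈ g ∧ ∀ z ∈ s, q z = p z) := by
  let d : DiffeologicalSpace A :=
    { plots := fun n => {q | ∀ x : Euc n, ∃ s : Set (Euc n), IsOpen s ∧ x ∈ s ∧
        ((∃ c, ∀ z ∈ s, q z = c) ∨
          ∃ p : Euc n → A, (⟨n, p⟩ : (n : ℕ) × (Euc n → A)) ∈ g ∧ ∀ z ∈ s, q z = p z)}
      constant_plots := fun c _ => ⟨Set.univ, isOpen_univ, trivial, Or.inl ⟨c, fun _ _ => rfl⟩⟩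
      plot_reparam := by
        intro n m p F hp hF x
        obtain ⟨s, hs, hx, h⟩ := hp (F x)
        refine ⟨F ⁻¹' s, hs.preimage hF.continuous, hx, ?_⟩
        rcases h with ⟨c, hc⟩ | ⟨p', hp', hc⟩
        · exact Or.inl ⟨c, fun z hz => hc _ hz⟩
        · exact Or.inr ⟨p' ∘ F, hg _ _ _ _ hF hp', fun z hz => hc _ hz⟩
      locality := by
        intro n p hp x
        obtain ⟨s, hs, hx, h⟩ := hp x
        obtain ⟨b, hb, hbs, hbx⟩ := exists_smooth_cutoff hs hx
        obtain ⟨s', hs', hx', h'⟩ := h hbs hb x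
        obtain ⟨t, ht, ht', hxt⟩ := eventually_nhds_iff.mp hbx
        refine ⟨s' ∩ t, hs'.inter ht', ⟨hx', hxt⟩, ?_⟩
        rcases h' with ⟨c, hc⟩ | ⟨p', hp', hc⟩
        · refine Or.inl ⟨c, fun z hz => ?_⟩
          rw [← hc z hz.1, Function.comp_apply, ht z hz.2]
        · refine Or.inr ⟨p', hp', fun z hz => ?_⟩
          rw [← hc z hz.1, Function.comp_apply, ht z hz.2] }
  exact hq d (fun p hp x => ⟨Set.univ, isOpen_univ, trivial, Or.inr ⟨p.2, hp, fun _ _ => rfl⟩⟩) x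

/-! ### Differential 1-forms and the pseudo-bundle `Λ¹(X)` -/

section Forms

variable {X : Type u} [DiffeologicalSpace X]

variable (X) in
/-- The space of differential 1-forms on `X`: smooth 1-forms `α p` on the domains of the plots `p`,
with `α (p ∘ F) = F^* (α p)` for all smooth `F`. -/
def oneForms : Submodule ℝ
    ((n : ℕ) → {p : Euc n → X // IsPlot p} → Euc n → (Euc n →L[ℝ] ℝ)) where
  carrier := {α | (∀ n p, ContDiff ℝ ∞ (α n p)) ∧
    ∀ (n m : ℕ) (p : {p : Euc n → X // IsPlot p}) (F : Euc m → Euc n) (hF : ContDiff ℝ ∞ F)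
      (z : Euc m), α m ⟨p.1 ∘ F, isPlot_reparam p.2 hF⟩ z = (α n p (F z)).comp (fderiv ℝ F z)}
  add_mem' := by
    rintro α η ⟨h1, h2⟩ ⟨h3, h4⟩
    refine ⟨fun n p => (h1 n p).add (h3 n p), fun n m p F hF z => ?_⟩
    simp only [Pi.add_apply, h2 n m p F hF z, h4 n m p F hF z, ContinuousLinearMap.add_comp]
  zero_mem' := ⟨fun _ _ => contDiff_const, fun n m p F hF z => by simp⟩
  smul_mem' := by
    rintro c α ⟨h1, h2⟩
    refine ⟨fun n p => (contDiff_const (c := c)).smul (h1 n p), fun n m p F hF z => ?_⟩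
    simp only [Pi.smul_apply, h2 n m p F hF z, ContinuousLinearMap.smul_comp]

variable (X) in
/-- `Ω¹(X)`. -/
def OneForm : Type u := ↥(oneForms X)

instance : AddCommGroup (OneForm X) := inferInstanceAs (AddCommGroup ↥(oneForms X))
instance : Module ℝ (OneForm X) := inferInstanceAs (Module ℝ ↥(oneForms X))

/-- The value of the form `α` on the plot `p` at the point `z`. -/
def OneForm.val (α : OneForm X) {n : ℕ} (p : Euc n → X) (hp : IsPlot p) (z : Euc n) :
    Euc n →L[ℝ] ℝ := α.1 n ⟨p, hp⟩ z

/-- The functional diffeology of `Ω¹(X)`: `q` is a plot if and only if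
`(z, z') ↦ (q z)(p)(z')` is smooth for every plot `p` of `X`. -/
instance : DiffeologicalSpace (OneForm X) where
  plots n := {q | ∀ (m : ℕ) (p : Euc m → X) (hp : IsPlot p),
    ContDiff ℝ ∞ (fun z : Euc n × Euc m => (q z.1).val p hp z.2)}
  constant_plots α := fun m p hp => (α.2.1 m ⟨p, hp⟩).comp contDiff_snd
  plot_reparam {n m q F} hq hF := fun k p hp =>
    (hq k p hp).comp ((hF.comp contDiff_fst).prodMk contDiff_snd)
  locality {n q} hq := by
    intro m p hp
    rw [contDiff_iff_contDiffAt]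
    rintro ⟨z, z'⟩
    obtain ⟨s, hs, hz, h⟩ := hq z
    obtain ⟨b, hb, hbs, hbz⟩ := exists_smooth_cutoff hs hz
    refine (h hbs hb m p hp).contDiffAt.congr_of_eventuallyEq ?_
    have : ∀ᶠ y in nhds (z, z'), b y.1 = y.1 :=
      (continuous_fst.tendsto (z, z')).eventually hbz
    filter_upwards [this] with y hy
    simp [hy]

/-- The space `Ω¹ₓ(X)` of the forms that vanish at `x`: `α(p)(0) = 0` for all plots `p` centred
at `x`. -/
def vanishingAt (x : X) : Submodule ℝ (OneForm X) where
  carrier := {α | ∀ (n : ℕ) (p : Euc n → X) (hp : IsPlot p), p 0 = x → α.val p hp 0 = 0}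
  add_mem' := by
    intro α η h1 h2 n p hp hx
    have : (α + η).val p hp 0 = α.val p hp 0 + η.val p hp 0 := rfl
    rw [this, h1 n p hp hx, h2 n p hp hx, add_zero]
  zero_mem' := fun _ _ _ _ => rfl
  smul_mem' := by
    intro c α h1 n p hp hx
    have : (c • α).val p hp 0 = c • α.val p hp 0 := rfl
    rw [this, h1 n p hp hx, smul_zero]

/-- The pullback of 1-forms along a smooth map. -/
def pullback {A : Type u₁} {B : Type u₂} [DiffeologicalSpace A] [DiffeologicalSpace B]
    (φ : A → B) (hφ : DSmooth φ) : OneForm B →ₗ[ℝ] OneForm A where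
  toFun α := ⟨fun n p => α.val (φ ∘ p.1) (hφ n p.1 p.2),
    fun _ _ => α.2.1 _ _, fun n m p F hF z => α.2.2 n m ⟨φ ∘ p.1, hφ n p.1 p.2⟩ F hF z⟩
  map_add' _ _ := rfl
  map_smul' _ _ := rfl

variable (X) in
/-- The space `C^∞(X, ℝ)`. -/
def SmoothFun : Type u := {h : X → ℝ // DSmooth h}

instance : CoeFun (SmoothFun X) (fun _ => X → ℝ) := ⟨Subtype.val⟩

/-- The differential of a smooth function, `p ↦ d(h ∘ p)`. -/
def SmoothFun.d (h : SmoothFun X) : OneForm X :=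
  ⟨fun _ p => fderiv ℝ (h ∘ p.1), by
    have key : ∀ (n : ℕ) (p : {p : Euc n → X // IsPlot p}), ContDiff ℝ ∞ (h ∘ p.1) :=
      fun n p => (h.2 n p.1 p.2).contDiff
    refine ⟨fun n p => (key n p).fderiv_right le_rfl, fun n m p F hF z => ?_⟩
    exact fderiv_comp z ((key n p).differentiable (by simp) _) (hF.differentiable (by simp) _)⟩

end Forms

/-! ### Pseudo-bundles -/

/-- A family of real vector spaces over `X` together with a diffeology on its total space. The
fibre over `x` of the projection of the total space `Σ x, V x` to `X` is `V x`. -/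
structure VectorFamily (X : Type u) where
  Fiber : X → Type v
  [addCommGroup : ∀ x, AddCommGroup (Fiber x)]
  [module : ∀ x, Module ℝ (Fiber x)]
  [total : DiffeologicalSpace (Σ x, Fiber x)]

attribute [instance] VectorFamily.addCommGroup VectorFamily.module VectorFamily.total

/-- The total space of the family. -/
abbrev VectorFamily.Total {X : Type u} (V : VectorFamily.{u, v} X) := Σ x, V.Fiber x

section Bundles

variable {X : Type u} [DiffeologicalSpace X]

/-- A diffeological vector pseudo-bundle: the projection, the zero section, the fibrewise addition
`V ×_X V → V` and the scalar multiplication `ℝ × V → V` are smooth. -/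
class IsPseudoBundle (V : VectorFamily.{u, v} X) : Prop where
  proj_smooth : DSmooth (fun a : V.Total => a.1)
  zero_smooth : DSmooth (fun x : X => (⟨x, 0⟩ : V.Total))
  add_smooth : ∀ (n : ℕ) (p : Euc n → X) (a b : ∀ z, V.Fiber (p z)),
    IsPlot (fun z => (⟨p z, a z⟩ : V.Total)) → IsPlot (fun z => (⟨p z, b z⟩ : V.Total)) →
      IsPlot (fun z => (⟨p z, a z + b z⟩ : V.Total))
  smul_smooth : ∀ (n : ℕ) (p : Euc n → X) (c : Euc n → ℝ) (a : ∀ z, V.Fiber (p z)),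
    IsPlot c → IsPlot (fun z => (⟨p z, a z⟩ : V.Total)) →
      IsPlot (fun z => (⟨p z, c z • a z⟩ : V.Total))

/-- The space `C^∞(X, V)` of smooth sections. -/
structure SmoothSection (V : VectorFamily.{u, v} X) where
  toFun : ∀ x, V.Fiber x
  smooth : DSmooth (fun x => (⟨x, toFun x⟩ : V.Total))

instance (V : VectorFamily.{u, v} X) : CoeFun (SmoothSection V) (fun _ => ∀ x, V.Fiber x) :=
  ⟨SmoothSection.toFun⟩

/-- The functional diffeology of `C^∞(X, V)`: `q` is a plot if and only if the evaluation
`(z, x) ↦ q(z)(x)` is smooth. -/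
instance (V : VectorFamily.{u, v} X) : DiffeologicalSpace (SmoothSection V) where
  plots n := {q | ∀ (k : ℕ) (F : Euc k → Euc n) (p : Euc k → X), ContDiff ℝ ∞ F → IsPlot p →
    IsPlot (fun z => (⟨p z, q (F z) (p z)⟩ : V.Total))}
  constant_plots s := fun _ _ _ _ hp => s.smooth _ _ hp
  plot_reparam hq hF := fun k F' p hF' hp => hq k _ p (hF.comp hF') hp
  locality {n q} hq := by
    intro k F p hF hp
    refine DiffeologicalSpace.locality fun z => ?_
    obtain ⟨s, hs, hz, h⟩ := hq (F z)
    refine ⟨F ⁻¹' s, hs.preimage hF.continuous, hz, fun {m f} hf hf' => ?_⟩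
    exact h (f := F ∘ f) hf (hF.comp hf') m id (p ∘ f) contDiff_id (isPlot_reparam hp hf')

instance (V : VectorFamily.{u, v} X) [IsPseudoBundle V] : Add (SmoothSection V) :=
  ⟨fun s t => ⟨fun x => s x + t x, fun n p hp =>
    IsPseudoBundle.add_smooth n p _ _ (s.smooth n p hp) (t.smooth n p hp)⟩⟩

instance (V : VectorFamily.{u, v} X) [IsPseudoBundle V] : SMul ℝ (SmoothSection V) :=
  ⟨fun c s => ⟨fun x => c • s x, fun n p hp =>
    IsPseudoBundle.smul_smooth n p (fun _ => c) _ isPlot_const (s.smooth n p hp)⟩⟩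

instance (V : VectorFamily.{u, v} X) [IsPseudoBundle V] : SMul (SmoothFun X) (SmoothSection V) :=
  ⟨fun h s => ⟨fun x => h x • s x, fun n p hp =>
    IsPseudoBundle.smul_smooth n p (h ∘ p) _ (h.2 n p hp) (s.smooth n p hp)⟩⟩

variable (X) in
/-- The pseudo-bundle `Λ¹(X)`, the quotient of `X × Ω¹(X)` with fibre `Ω¹(X) / Ω¹ₓ(X)` at `x`. -/
def lambdaOne : VectorFamily.{u, u} X where
  Fiber x := OneForm X ⧸ vanishingAt x
  total := pushforwardDiffeology (fun a : X × OneForm X =>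
    (⟨a.1, Submodule.Quotient.mk a.2⟩ : Σ x : X, OneForm X ⧸ vanishingAt x))

/-- The element of `Λ¹ₓ(X)` represented by the form `α`. -/
def OneForm.at (α : OneForm X) (x : X) : (lambdaOne X).Fiber x := (vanishingAt x).mkQ α

/-- The pullback map `Λ¹_{φ(a)}(B) → Λ¹_a(A)` of a smooth map `φ`. -/
def pullbackLambda {A : Type u₁} {B : Type u₂} [DiffeologicalSpace A] [DiffeologicalSpace B]
    (φ : A → B) (hφ : DSmooth φ) (a : A) (b : B) (h : φ a = b) :
    (lambdaOne B).Fiber b →ₗ[ℝ] (lambdaOne A).Fiber a :=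
  Submodule.mapQ (vanishingAt b) (vanishingAt a) (pullback φ hφ) fun α hα n p hp hx =>
    hα n (φ ∘ p) (hφ n p hp) (by rw [Function.comp_apply, hx, h])

/-- The tensor product of pseudo-bundles. Its plots are locally the finite sums
`z ↦ ∑ᵢ aᵢ(z) ⊗ bᵢ(z)` with plots `aᵢ`, `bᵢ` of the factors over one plot of `X`; it is the finest
diffeology of a pseudo-bundle for which `V ×_X W → V ⊗ W` is smooth. -/
def VectorFamily.tensor (V : VectorFamily.{u, v} X) (W : VectorFamily.{u, w} X) :
    VectorFamily.{u, max v w} X where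
  Fiber x := V.Fiber x ⊗[ℝ] W.Fiber x
  total := DiffeologicalSpace.generateFrom
    {q | ∃ (N : ℕ) (p : Euc q.1 → X) (a : Fin N → ∀ z, V.Fiber (p z))
      (b : Fin N → ∀ z, W.Fiber (p z)), IsPlot p ∧
      (∀ i, IsPlot (fun z => (⟨p z, a i z⟩ : V.Total))) ∧
      (∀ i, IsPlot (fun z => (⟨p z, b i z⟩ : W.Total))) ∧
      q.2 = fun z => ⟨p z, ∑ i, a i z ⊗ₜ[ℝ] b i z⟩}

/-- The tensor product `a ⊗ b` of elements of the fibres at `x`. -/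
def VectorFamily.tmul (V : VectorFamily.{u, v} X) (W : VectorFamily.{u, w} X) {x : X}
    (a : V.Fiber x) (b : W.Fiber x) : (V.tensor W).Fiber x := a ⊗ₜ[ℝ] b

/-- The fibres carry the subset diffeology of the total space. -/
@[reducible] def VectorFamily.fiberDiffeology (V : VectorFamily.{u, v} X) (x : X) :
    DiffeologicalSpace (V.Fiber x) := inducedDiffeology (fun a => (⟨x, a⟩ : V.Total))

/-- The diffeological dual of the fibre at `x`: the smooth linear functionals. -/
def VectorFamily.smoothDual (V : VectorFamily.{u, v} X) (x : X) :
    Submodule ℝ (Module.Dual ℝ (V.Fiber x)) where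
  carrier := {φ | @DSmooth _ _ (V.fiberDiffeology x) _ φ}
  add_mem' := by
    intro φ ψ hφ hψ n p hp
    exact ((hφ n p hp).contDiff.add (hψ n p hp).contDiff).isPlot
  zero_mem' := fun n p hp => (contDiff_const (c := (0 : ℝ))).isPlot
  smul_mem' := by
    intro c φ hφ n p hp
    exact (contDiff_const.smul (hφ n p hp).contDiff).isPlot

/-- The dual pseudo-bundle: `q` is a plot if and only if its projection to `X` is one and the
evaluation of `q` on each plot of `V` is smooth wherever it is defined. -/
def VectorFamily.dual (V : VectorFamily.{u, v} X) : VectorFamily.{u, v} X where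
  Fiber x := V.smoothDual x
  total :=
    { plots := fun n => {q | IsPlot (fun z => (q z).1) ∧
        ∀ (k : ℕ) (F : Euc k → Euc n) (a : ∀ z, V.Fiber (q (F z)).1), ContDiff ℝ ∞ F →
          IsPlot (fun z => (⟨(q (F z)).1, a z⟩ : V.Total)) →
          IsPlot (fun z => (q (F z)).2.1 (a z))}
      constant_plots := by
        rintro n ⟨x, φ⟩
        exact ⟨isPlot_const, fun k F a _ ha => φ.2 k a ha⟩
      plot_reparam := fun {n m q G} hq hG =>
        ⟨isPlot_reparam hq.1 hG, fun k F a hF ha => hq.2 k (G ∘ F) a (hG.comp hF) ha⟩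
      locality := by
        intro n q hq
        refine ⟨DiffeologicalSpace.locality fun z => ?_, fun k F a hF ha =>
          DiffeologicalSpace.locality fun z => ?_⟩
        · obtain ⟨s, hs, hz, h⟩ := hq z
          exact ⟨s, hs, hz, fun hf hf' => (h hf hf').1⟩
        · obtain ⟨s, hs, hz, h⟩ := hq (F z)
          refine ⟨F ⁻¹' s, hs.preimage hF.continuous, hz, fun {m f} hf hf' => ?_⟩
          exact (h (f := F ∘ f) hf (hF.comp hf')).2 m id (fun y => a (f y)) contDiff_id
            (isPlot_reparam ha hf') }

/-- A pseudo-metric: a smooth section of `V^* ⊗ V^*` whose values (here seen as bilinear forms)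
are symmetric, positive semidefinite and of rank `dim (V_x)^*`. -/
structure IsPseudoMetric (V : VectorFamily.{u, v} X)
    (g : ∀ x, LinearMap.BilinForm ℝ (V.Fiber x)) : Prop where
  smooth : ∃ σ : SmoothSection (V.dual.tensor V.dual), ∀ x (a b : V.Fiber x),
    g x a b = TensorProduct.dualDistrib ℝ (V.Fiber x) (V.Fiber x)
      (TensorProduct.map (V.smoothDual x).subtype (V.smoothDual x).subtype (σ x)) (a ⊗ₜ[ℝ] b)
  symm : ∀ x a b, g x a b = g x b a
  nonneg : ∀ x a, 0 ≤ g x a a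
  rank_eq : ∀ x, Module.finrank ℝ (LinearMap.range (g x)) = Module.finrank ℝ (V.smoothDual x)

/-- A connection: a smooth linear operator `C^∞(X, V) → C^∞(X, Λ¹(X) ⊗ V)` that satisfies the
Leibniz rule. -/
structure Connection (V : VectorFamily.{u, v} X) [IsPseudoBundle V] where
  toFun : SmoothSection V → SmoothSection ((lambdaOne X).tensor V)
  smooth : DSmooth toFun
  map_add : ∀ s t x, toFun (s + t) x = toFun s x + toFun t x
  map_smul : ∀ (c : ℝ) s x, toFun (c • s) x = c • toFun s x
  leibniz : ∀ (h : SmoothFun X) s x, toFun (h • s) x = (lambdaOne X).tmul V (h.d.at x) (s x) + h x • toFun s x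

/-- The contraction `Λ ⊗ E → Λ`, `α ⊗ a ↦ φ(a) α`, by a linear functional `φ` on `E`. -/
def contract {L : Type u} {E : Type v} [AddCommGroup L] [Module ℝ L] [AddCommGroup E] [Module ℝ E]
    (φ : E →ₗ[ℝ] ℝ) : L ⊗[ℝ] E →ₗ[ℝ] L :=
  (TensorProduct.rid ℝ L).toLinearMap ∘ₗ TensorProduct.map LinearMap.id φ

/-- The operator `D` is compatible with `g`: for all smooth sections `s`, `t` the function
`g(s, t)` is smooth and `d(g(s, t)) = g(D s, t) + g(s, D t)` as sections of `Λ¹(X)`, where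
`g(α ⊗ s, t) = g(s, α ⊗ t) = g(s, t) α`. -/
def MetricCompatible (V : VectorFamily.{u, v} X)
    (D : SmoothSection V → ∀ x, ((lambdaOne X).tensor V).Fiber x)
    (g : ∀ x, LinearMap.BilinForm ℝ (V.Fiber x)) : Prop :=
  ∀ s t : SmoothSection V, ∃ h : SmoothFun X, (∀ x, h x = g x (s x) (t x)) ∧
    ∀ x, h.d.at x = contract ((g x).flip (t x)) (D s x) + contract (g x (s x)) (D t x)

end Bundles

/-! ### Gluing of spaces -/

/-- The set `X₁ ∪_f X₂ = (X₁ ⊔ X₂) / (y ∼ f(y))`, written as the disjoint union of `X₁ ∖ Y` and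
`X₂`; see `Glue.mk_surjective` and `Glue.mk_eq_iff` for the quotient projection. -/
inductive Glue {X₁ : Type u₁} {X₂ : Type u₂} (Y : Set X₁) (f : Y → X₂) : Type (max u₁ u₂)
  | left (x : X₁) (h : x ∉ Y) : Glue Y f
  | right (x : X₂) : Glue Y f

namespace Glue

section Sets

variable {X₁ : Type u₁} {X₂ : Type u₂} {Y : Set X₁} {f : Y → X₂}

open Classical in
/-- The canonical map `X₁ → X₁ ∪_f X₂`. -/
def inc₁ (Y : Set X₁) (f : Y → X₂) (x : X₁) : Glue Y f :=
  if h : x ∈ Y then right (f ⟨x, h⟩) else left x h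

/-- The canonical map `X₂ → X₁ ∪_f X₂`. -/
def inc₂ (Y : Set X₁) (f : Y → X₂) (x : X₂) : Glue Y f := right x

/-- The quotient projection `X₁ ⊔ X₂ → X₁ ∪_f X₂`. -/
def mk (Y : Set X₁) (f : Y → X₂) : X₁ ⊕ X₂ → Glue Y f := Sum.elim (inc₁ Y f) (inc₂ Y f)

theorem inc₁_of_mem {x : X₁} (h : x ∈ Y) : inc₁ Y f x = right (f ⟨x, h⟩) := dif_pos h

theorem inc₁_of_notMem {x : X₁} (h : x ∉ Y) : inc₁ Y f x = left x h := dif_neg h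

theorem mk_surjective : Function.Surjective (mk Y f) := by
  rintro (⟨x, h⟩ | x)
  · exact ⟨Sum.inl x, inc₁_of_notMem h⟩
  · exact ⟨Sum.inr x, rfl⟩

/-- `X₁ ∪_f X₂` is the quotient of `X₁ ⊔ X₂` by the relation generated by `y ∼ f(y)`. -/
theorem mk_eq_iff (a b : X₁ ⊕ X₂) : mk Y f a = mk Y f b ↔
    Relation.EqvGen (fun c d => ∃ y : Y, c = Sum.inl y.1 ∧ d = Sum.inr (f y)) a b := by
  have nf : ∀ c : X₁ ⊕ X₂, (∃ x, ∃ h : x ∉ Y, mk Y f c = left x h ∧ c = Sum.inl x) ∨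
      ∃ x, mk Y f c = right x ∧ Relation.EqvGen
        (fun c d => ∃ y : Y, c = Sum.inl y.1 ∧ d = Sum.inr (f y)) c (Sum.inr x) := by
    rintro (x | x)
    · by_cases h : x ∈ Y
      · exact Or.inr ⟨_, inc₁_of_mem h, .rel _ _ ⟨⟨x, h⟩, rfl, rfl⟩⟩
      · exact Or.inl ⟨x, h, inc₁_of_notMem h, rfl⟩
    · exact Or.inr ⟨x, rfl, .refl _⟩
  constructor
  · intro hab
    rcases nf a with ⟨x, h, ha, rfl⟩ | ⟨x, ha, ha'⟩ <;>
      rcases nf b with ⟨x', h', hb, rfl⟩ | ⟨x', hb, hb'⟩ <;> rw [ha, hb] at hab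
    · cases hab; exact .refl _
    · cases hab
    · cases hab
    · cases hab; exact .trans _ _ _ ha' (.symm _ _ hb')
  · intro h
    induction h with
    | rel c d h => obtain ⟨y, rfl, rfl⟩ := h; exact inc₁_of_mem y.2
    | refl => rfl
    | symm _ _ _ ih => exact ih.symm
    | trans _ _ _ _ _ ih ih' => exact ih.trans ih'

theorem inc₁_injective (hf : Function.Injective f) : Function.Injective (inc₁ Y f) := by
  intro x x' h
  by_cases hx : x ∈ Y <;> by_cases hx' : x' ∈ Y
  · rw [inc₁_of_mem hx, inc₁_of_mem hx'] at h
    injection h with h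
    exact congrArg Subtype.val (hf h)
  · rw [inc₁_of_mem hx, inc₁_of_notMem hx'] at h; cases h
  · rw [inc₁_of_notMem hx, inc₁_of_mem hx'] at h; cases h
  · rw [inc₁_of_notMem hx, inc₁_of_notMem hx'] at h; cases h; rfl

theorem exists_of_inc₁_eq_right {x : X₁} {z : X₂} (h : inc₁ Y f x = right z) :
    ∃ hx : x ∈ Y, f ⟨x, hx⟩ = z := by
  by_cases hx : x ∈ Y
  · rw [inc₁_of_mem hx] at h
    injection h with h
    exact ⟨hx, h⟩
  · rw [inc₁_of_notMem hx] at h; cases h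

end Sets

section Spaces

variable {X₁ : Type u₁} {X₂ : Type u₂} [DiffeologicalSpace X₁] [DiffeologicalSpace X₂]
  {Y : Set X₁} {f : Y → X₂}

/-- The gluing diffeology: the quotient diffeology of the disjoint union diffeology. -/
instance : DiffeologicalSpace (Glue Y f) := pushforwardDiffeology (mk Y f)

theorem inc₁_smooth : DSmooth (inc₁ Y f) := fun _ p hp =>
  DiffeologicalSpace.isPlot_generatedFrom_of_mem
    ⟨Sum.inl ∘ p, DiffeologicalSpace.isPlot_generatedFrom_of_mem (Or.inl ⟨p, hp, rfl⟩), rfl⟩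

theorem inc₂_smooth : DSmooth (inc₂ Y f) := fun _ p hp =>
  DiffeologicalSpace.isPlot_generatedFrom_of_mem
    ⟨Sum.inr ∘ p, DiffeologicalSpace.isPlot_generatedFrom_of_mem (Or.inr ⟨p, hp, rfl⟩), rfl⟩

/-- Plots of `X₁ ∪_f X₂` lift locally to a plot of `X₁` or to a plot of `X₂`. -/
theorem isPlot_local {n : ℕ} {q : Euc n → Glue Y f} (hq : IsPlot q) (x : Euc n) :
    ∃ s : Set (Euc n), IsOpen s ∧ x ∈ s ∧
      ((∃ p : Euc n → X₁, IsPlot p ∧ ∀ z ∈ s, q z = inc₁ Y f (p z)) ∨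
        ∃ p : Euc n → X₂, IsPlot p ∧ ∀ z ∈ s, q z = inc₂ Y f (p z)) := by
  obtain ⟨s, hs, hx, h⟩ := isPlot_generateFrom (by
    rintro n m r F hF ⟨p, hp, hr⟩
    exact ⟨p ∘ F, isPlot_reparam hp hF, congrArg (· ∘ F) hr⟩) hq x
  rcases h with ⟨c, hc⟩ | ⟨r, ⟨p, hp, hr⟩, hc⟩
  · refine ⟨s, hs, hx, ?_⟩
    obtain ⟨a | a, rfl⟩ := mk_surjective c
    · exact Or.inl ⟨fun _ => a, isPlot_const, hc⟩
    · exact Or.inr ⟨fun _ => a, isPlot_const, hc⟩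
  · obtain ⟨t, ht, hxt, h⟩ := isPlot_generateFrom (by
      rintro n m r F hF (⟨p, hp, hr⟩ | ⟨p, hp, hr⟩)
      · exact Or.inl ⟨p ∘ F, isPlot_reparam hp hF, congrArg (· ∘ F) hr⟩
      · exact Or.inr ⟨p ∘ F, isPlot_reparam hp hF, congrArg (· ∘ F) hr⟩) hp x
    have hr' : ∀ z, r z = mk Y f (p z) := fun z => congrFun hr z
    refine ⟨s ∩ t, hs.inter ht, ⟨hx, hxt⟩, ?_⟩
    rcases h with ⟨c | c, hc'⟩ | ⟨r', ⟨p', hp', hr''⟩ | ⟨p', hp', hr''⟩, hc'⟩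
    · exact Or.inl ⟨fun _ => c, isPlot_const, fun z hz => by
        rw [hc z hz.1, hr', hc' z hz.2]; rfl⟩
    · exact Or.inr ⟨fun _ => c, isPlot_const, fun z hz => by
        rw [hc z hz.1, hr', hc' z hz.2]; rfl⟩
    · exact Or.inl ⟨p', hp', fun z hz => by
        rw [hc z hz.1, hr', hc' z hz.2, show r' z = _ from congrFun hr'' z]; rfl⟩
    · exact Or.inr ⟨p', hp', fun z hz => by
        rw [hc z hz.1, hr', hc' z hz.2, show r' z = _ from congrFun hr'' z]; rfl⟩

theorem isPlot_of_inc₁ (hf : IsDiffeoOntoImage f) {n : ℕ} {q : Euc n → X₁}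
    (hq : IsPlot (inc₁ Y f ∘ q)) : IsPlot q := by
  refine DiffeologicalSpace.locality fun x => ?_
  obtain ⟨s, hs, hx, ⟨p, hp, h⟩ | ⟨p, hp, h⟩⟩ := isPlot_local hq x
  · refine ⟨s, hs, hx, fun {m F} hF hF' => ?_⟩
    have : q ∘ F = p ∘ F := funext fun z => inc₁_injective hf.1 (h _ (hF z))
    rw [this]
    exact isPlot_reparam hp hF'
  · refine ⟨s, hs, hx, fun {m F} hF hF' => ?_⟩
    have hmem : ∀ z, ∃ hz : q (F z) ∈ Y, f ⟨q (F z), hz⟩ = p (F z) := fun z =>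
      exists_of_inc₁_eq_right (h _ (hF z))
    obtain ⟨ψ, hψ, hψf⟩ := hf.2.2
    have h1 : IsPlot (fun z => (⟨f ⟨q (F z), (hmem z).1⟩, Set.mem_range_self _⟩ : Set.range f)) := by
      change IsPlot (fun z => f ⟨q (F z), (hmem z).1⟩)
      simp only [fun z => (hmem z).2]
      exact isPlot_reparam hp hF'
    have h2 := hψ _ _ h1
    simp only [Function.comp_def, hψf] at h2
    exact h2

theorem isPlot_of_inc₂ (hf : DSmooth f) {n : ℕ} {q : Euc n → X₂}
    (hq : IsPlot (inc₂ Y f ∘ q)) : IsPlot q := by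
  refine DiffeologicalSpace.locality fun x => ?_
  obtain ⟨s, hs, hx, ⟨p, hp, h⟩ | ⟨p, hp, h⟩⟩ := isPlot_local hq x
  · refine ⟨s, hs, hx, fun {m F} hF hF' => ?_⟩
    have hmem : ∀ z, ∃ hz : p (F z) ∈ Y, f ⟨p (F z), hz⟩ = q (F z) := fun z =>
      exists_of_inc₁_eq_right (h _ (hF z)).symm
    have h1 : IsPlot (fun z => (⟨p (F z), (hmem z).1⟩ : Y)) := isPlot_reparam hp hF'
    have h2 := hf _ _ h1
    simp only [Function.comp_def, fun z => (hmem z).2] at h2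
    exact h2
  · refine ⟨s, hs, hx, fun {m F} hF hF' => ?_⟩
    have : q ∘ F = p ∘ F := funext fun z => by
      have := h _ (hF z)
      simp only [Function.comp_apply, inc₂] at this
      injection this
    rw [this]
    exact isPlot_reparam hp hF'

/-- A form on `X₁ ∪_f X₂` vanishes at a point if its pullbacks to `X₁` and `X₂` vanish at the
preimages of the point. -/
theorem mem_vanishingAt {α : OneForm (Glue Y f)} {x : Glue Y f}
    (h₁ : ∀ a, inc₁ Y f a = x → pullback _ inc₁_smooth α ∈ vanishingAt a)
    (h₂ : ∀ b, inc₂ Y f b = x → pullback _ inc₂_smooth α ∈ vanishingAt b) :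
    α ∈ vanishingAt x := by
  intro n q hq hx
  obtain ⟨s, hs, h0, h⟩ := isPlot_local hq 0
  obtain ⟨b, hb, hbs, hb0⟩ := exists_smooth_cutoff hs h0
  have hb00 : b 0 = 0 := hb0.self_of_nhds
  have key : α.val q hq 0 = α.val (q ∘ b) (isPlot_reparam hq hb) 0 := by
    have h1 := α.2.2 n n ⟨q, hq⟩ b hb 0
    have h2 : fderiv ℝ b 0 = ContinuousLinearMap.id ℝ (Euc n) := by
      have : b =ᶠ[nhds 0] id := hb0
      rw [this.fderiv_eq, fderiv_id]
    rw [h2, hb00, ContinuousLinearMap.comp_id] at h1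
    exact h1.symm
  rw [key]
  rcases h with ⟨p, hp, h⟩ | ⟨p, hp, h⟩
  · have e : q ∘ b = inc₁ Y f ∘ (p ∘ b) := funext fun z => h _ (hbs z)
    have e0 : inc₁ Y f (p (b 0)) = x := by rw [← h _ (hbs 0), hb00, hx]
    have := h₁ _ e0 n (p ∘ b) (isPlot_reparam hp hb) rfl
    simp only [e]
    exact this
  · have e : q ∘ b = inc₂ Y f ∘ (p ∘ b) := funext fun z => h _ (hbs z)
    have e0 : inc₂ Y f (p (b 0)) = x := by rw [← h _ (hbs 0), hb00, hx]
    have := h₂ _ e0 n (p ∘ b) (isPlot_reparam hp hb) rfl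
    simp only [e]
    exact this

/-- The map `ρ̃₁ : Λ¹_x(X₁ ∪_f X₂) → Λ¹_a(X₁)` induced by the canonical map `X₁ → X₁ ∪_f X₂`, at a
point `x` that is the image of `a`. -/
def rho₁ (a : X₁) (x : Glue Y f) (h : inc₁ Y f a = x) :
    (lambdaOne (Glue Y f)).Fiber x →ₗ[ℝ] (lambdaOne X₁).Fiber a :=
  pullbackLambda _ inc₁_smooth a x h

/-- The map `ρ̃₂ : Λ¹_x(X₁ ∪_f X₂) → Λ¹_b(X₂)` induced by the canonical map `X₂ → X₁ ∪_f X₂`, at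
the image `x` of `b`. -/
def rho₂ (b : X₂) :
    (lambdaOne (Glue Y f)).Fiber (right b) →ₗ[ℝ] (lambdaOne X₂).Fiber b :=
  pullbackLambda _ inc₂_smooth b (right b) rfl

theorem ker_rho₁ (a : X₁) (ha : a ∉ Y) :
    LinearMap.ker (rho₁ a (left a ha) (inc₁_of_notMem ha) :
      (lambdaOne (Glue Y f)).Fiber _ →ₗ[ℝ] _) = ⊥ := by
  rw [LinearMap.ker_eq_bot']
  intro m hm
  obtain ⟨α, rfl⟩ := Submodule.mkQ_surjective _ m
  have hm' : pullback _ inc₁_smooth α ∈ vanishingAt a := (Submodule.Quotient.mk_eq_zero _).1 hm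
  refine (Submodule.Quotient.mk_eq_zero _).2 (mem_vanishingAt ?_ ?_)
  · intro a' ha'
    by_cases h : a' ∈ Y
    · rw [inc₁_of_mem h] at ha'; cases ha'
    · rw [inc₁_of_notMem h] at ha'; cases ha'; exact hm'
  · intro b hb; cases hb

theorem ker_rho₂ (b : X₂) (hb : b ∉ Set.range f) :
    LinearMap.ker (rho₂ b : (lambdaOne (Glue Y f)).Fiber _ →ₗ[ℝ] _) = ⊥ := by
  rw [LinearMap.ker_eq_bot']
  intro m hm
  obtain ⟨α, rfl⟩ := Submodule.mkQ_surjective _ m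
  have hm' : pullback _ inc₂_smooth α ∈ vanishingAt b := (Submodule.Quotient.mk_eq_zero _).1 hm
  refine (Submodule.Quotient.mk_eq_zero _).2 (mem_vanishingAt ?_ ?_)
  · intro a ha
    obtain ⟨h, h'⟩ := exists_of_inc₁_eq_right ha
    exact absurd ⟨_, h'⟩ hb
  · intro b' hb'; cases hb'; exact hm'

theorem ker_rho_prod (hf : Function.Injective f) (y : Y) (b : X₂) (hb : f y = b) :
    LinearMap.ker ((rho₁ y.1 (right b) ((inc₁_of_mem y.2).trans (congrArg right hb))).prod
      (rho₂ b) : (lambdaOne (Glue Y f)).Fiber (right b) →ₗ[ℝ] _) = ⊥ := by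
  rw [LinearMap.ker_eq_bot']
  intro m hm
  obtain ⟨α, rfl⟩ := Submodule.mkQ_surjective _ m
  have hm₁ : pullback _ inc₁_smooth α ∈ vanishingAt y.1 :=
    (Submodule.Quotient.mk_eq_zero _).1 (congrArg Prod.fst hm)
  have hm₂ : pullback _ inc₂_smooth α ∈ vanishingAt b :=
    (Submodule.Quotient.mk_eq_zero _).1 (congrArg Prod.snd hm)
  refine (Submodule.Quotient.mk_eq_zero _).2 (mem_vanishingAt ?_ ?_)
  · intro a ha
    obtain ⟨h, h'⟩ := exists_of_inc₁_eq_right ha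
    have : (⟨a, h⟩ : Y) = y := hf (h'.trans hb.symm)
    cases this
    exact hm₁
  · intro b' hb'; cases hb'; exact hm₂

end Spaces

end Glue

/-! ### Gluing of pseudo-bundles along diffeomorphisms -/

section BundleGluing

variable {X₁ : Type u₁} {X₂ : Type u₂} [DiffeologicalSpace X₁] [DiffeologicalSpace X₂]

/-- The map of total spaces `π₁⁻¹(Y) → V₂` given by a family of maps of fibres over `f`. -/
def totalMap {V₁ : VectorFamily.{u₁, v} X₁} {V₂ : VectorFamily.{u₂, v} X₂} {Y : Set X₁}
    {f : Y → X₂} (F : ∀ y : Y, V₁.Fiber y.1 ≃ₗ[ℝ] V₂.Fiber (f y))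
    (a : ↥{a : V₁.Total | a.1 ∈ Y}) : V₂.Total :=
  ⟨f ⟨a.1.1, a.2⟩, F ⟨a.1.1, a.2⟩ a.1.2⟩

/-- A gluing `(f̃, f)` of `V₁` to `V₂`: a diffeomorphism `f` of a subset `Y` of `X₁` with a subset
of `X₂`, and a diffeomorphism `f̃` of `π₁⁻¹(Y)` with `π₂⁻¹(f(Y))` that lifts `f` and is linear on
the fibres. -/
structure BundleGluing (V₁ : VectorFamily.{u₁, v} X₁) (V₂ : VectorFamily.{u₂, v} X₂) where
  Y : Set X₁
  f : Y → X₂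
  lift : ∀ y : Y, V₁.Fiber y.1 ≃ₗ[ℝ] V₂.Fiber (f y)
  f_diffeo : IsDiffeoOntoImage f
  lift_diffeo : IsDiffeoOntoImage (totalMap lift)

namespace BundleGluing

variable {V₁ : VectorFamily.{u₁, v} X₁} {V₂ : VectorFamily.{u₂, v} X₂} (G : BundleGluing V₁ V₂)

/-- The glued base `X₁ ∪_f X₂`. -/
abbrev Base := Glue G.Y G.f

/-- The glued total space `V₁ ∪_f̃ V₂`. -/
abbrev GluedTotal := Glue {a : V₁.Total | a.1 ∈ G.Y} (totalMap G.lift)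

/-- The fibres of `V₁ ∪_f̃ V₂` over `X₁ ∪_f X₂`: those of `V₁` over `X₁ ∖ Y` and those of `V₂` over
`X₂`. -/
def GluedFiber : G.Base → Type v
  | .left x _ => V₁.Fiber x
  | .right x => V₂.Fiber x

instance : ∀ x, AddCommGroup (G.GluedFiber x)
  | .left x _ => inferInstanceAs (AddCommGroup (V₁.Fiber x))
  | .right x => inferInstanceAs (AddCommGroup (V₂.Fiber x))

instance : ∀ x, Module ℝ (G.GluedFiber x)
  | .left x _ => inferInstanceAs (Module ℝ (V₁.Fiber x))
  | .right x => inferInstanceAs (Module ℝ (V₂.Fiber x))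

/-- The tautological bijection of the union of the fibres with `V₁ ∪_f̃ V₂`. -/
def toGluedTotal : (Σ x, G.GluedFiber x) → G.GluedTotal
  | ⟨.left x h, a⟩ => .left ⟨x, a⟩ h
  | ⟨.right x, a⟩ => .right ⟨x, a⟩

theorem toGluedTotal_bijective : Function.Bijective G.toGluedTotal := by
  constructor
  · rintro ⟨x | x, a⟩ ⟨x' | x', a'⟩ h <;> simp only [toGluedTotal] at h <;> cases h <;> rfl
  · rintro (⟨⟨x, a⟩, h⟩ | ⟨x, a⟩)
    · exact ⟨⟨.left x h, a⟩, rfl⟩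
    · exact ⟨⟨.right x, a⟩, rfl⟩

/-- The glued pseudo-bundle `V₁ ∪_f̃ V₂ → X₁ ∪_f X₂`, with the gluing diffeology on
`V₁ ∪_f̃ V₂`. -/
def glued : VectorFamily.{max u₁ u₂, v} G.Base where
  Fiber := G.GluedFiber
  total := inducedDiffeology G.toGluedTotal

/-- Sections `s₁`, `s₂` are compatible if `f̃ ∘ s₁ = s₂ ∘ f` on `Y`. -/
def CompatibleSections (s₁ : SmoothSection V₁) (s₂ : SmoothSection V₂) : Prop :=
  ∀ y : G.Y, G.lift y (s₁ y.1) = s₂ (G.f y)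

open Classical in
/-- The values of the section `s₁` of `V₁` in the presentation `s = s₁ ∪ s₂`. -/
def restrictFun (s : ∀ x, G.GluedFiber x) (x : X₁) : V₁.Fiber x :=
  if h : x ∈ G.Y then (G.lift ⟨x, h⟩).symm (s (.right (G.f ⟨x, h⟩))) else s (.left x h)

theorem restrictFun_of_mem (s : ∀ x, G.GluedFiber x) {x : X₁} (h : x ∈ G.Y) :
    G.restrictFun s x = (G.lift ⟨x, h⟩).symm (s (.right (G.f ⟨x, h⟩))) := dif_pos h

theorem restrictFun_of_notMem (s : ∀ x, G.GluedFiber x) {x : X₁} (h : x ∉ G.Y) :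
    G.restrictFun s x = s (.left x h) := dif_neg h

theorem inc₁_restrictFun (s : ∀ x, G.GluedFiber x) (x : X₁) :
    (Glue.inc₁ {a : V₁.Total | a.1 ∈ G.Y} (totalMap G.lift) ⟨x, G.restrictFun s x⟩) =
      G.toGluedTotal ⟨Glue.inc₁ G.Y G.f x, s (Glue.inc₁ G.Y G.f x)⟩ := by
  by_cases hx : x ∈ G.Y
  · rw [Glue.inc₁_of_mem (Y := {a : V₁.Total | a.1 ∈ G.Y}) hx, Glue.inc₁_of_mem hx]
    refine congrArg Glue.right (Sigma.ext rfl (heq_of_eq ?_))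
    change G.lift ⟨x, hx⟩ (G.restrictFun s x) = _
    rw [restrictFun_of_mem G s hx]
    exact (G.lift ⟨x, hx⟩).apply_symm_apply _
  · rw [Glue.inc₁_of_notMem (Y := {a : V₁.Total | a.1 ∈ G.Y}) hx, Glue.inc₁_of_notMem hx]
    have : ∀ a a' : V₁.Fiber x, a = a' →
        (Glue.left (Y := {a : V₁.Total | a.1 ∈ G.Y}) (f := totalMap G.lift) ⟨x, a⟩ hx) =
          Glue.left ⟨x, a'⟩ hx := by rintro a _ rfl; rfl
    exact this _ _ (restrictFun_of_notMem G s hx)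

/-- The section `s₁` of `V₁` in the presentation `s = s₁ ∪ s₂` of a section of the glued
pseudo-bundle. -/
def restrict₁ (s : SmoothSection G.glued) : SmoothSection V₁ where
  toFun := G.restrictFun s.toFun
  smooth n p hp := by
    refine Glue.isPlot_of_inc₁ G.lift_diffeo ?_
    have h := s.smooth n _ (Glue.inc₁_smooth (f := G.f) n p hp)
    have h' : IsPlot (G.toGluedTotal ∘ _) := h
    convert h' using 1
    funext z
    exact G.inc₁_restrictFun s.toFun (p z)

/-- The section `s₂` of `V₂` in the presentation `s = s₁ ∪ s₂` of a section of the glued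
pseudo-bundle. -/
def restrict₂ (s : SmoothSection G.glued) : SmoothSection V₂ where
  toFun x := s (.right x)
  smooth n p hp := by
    refine Glue.isPlot_of_inc₂ G.lift_diffeo.2.1 ?_
    exact s.smooth n _ (Glue.inc₂_smooth (f := G.f) n p hp)

theorem compatible_restrict (s : SmoothSection G.glued) :
    G.CompatibleSections (G.restrict₁ s) (G.restrict₂ s) := by
  intro y
  change G.lift y (G.restrictFun s.toFun y.1) = s.toFun (.right (G.f y))
  exact (congrArg (G.lift y) (restrictFun_of_mem G _ y.2)).trans ((G.lift y).apply_symm_apply _)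

/-- The pseudo-metrics are compatible with the gluing. -/
def CompatibleMetrics (g₁ : ∀ x, LinearMap.BilinForm ℝ (V₁.Fiber x))
    (g₂ : ∀ x, LinearMap.BilinForm ℝ (V₂.Fiber x)) : Prop :=
  ∀ (y : G.Y) (a b : V₁.Fiber y.1), g₁ y.1 a b = g₂ (G.f y) (G.lift y a) (G.lift y b)

/-- The induced pseudo-metric `g̃`. -/
def inducedMetric (g₁ : ∀ x, LinearMap.BilinForm ℝ (V₁.Fiber x))
    (g₂ : ∀ x, LinearMap.BilinForm ℝ (V₂.Fiber x)) :
    ∀ x, LinearMap.BilinForm ℝ (G.glued.Fiber x)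
  | .left x _ => g₁ x
  | .right x => g₂ x

/-- The inclusion `Y → X₁` is smooth. -/
theorem inclusion_smooth : DSmooth (Subtype.val : G.Y → X₁) := fun _ _ hp => hp

/-- The extendibility condition `𝒟₁^Ω = 𝒟₂^Ω`: the pushforwards to `Ω¹(Y)` of the diffeologies of
`Ω¹(X₁)` and `Ω¹(X₂)` by the pullbacks along the inclusion `Y → X₁` and along `f : Y → X₂`
coincide. -/
def ExtendibilityCondition : Prop :=
  pushforwardDiffeology (pullback (Subtype.val : G.Y → X₁) G.inclusion_smooth) =
    pushforwardDiffeology (pullback G.f G.f_diffeo.2.1)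

/-- Compatible connections: for all compatible `s₁`, `s₂` and all `y ∈ Y` one has
`(i^* ⊗ f̃)((∇¹ s₁)(y)) = (f^* ⊗ Id)((∇² s₂)(f(y)))` in `Λ¹_y(Y) ⊗ (V₂)_{f(y)}`, where `i^*` and
`f^*` are the pullbacks along the inclusion `Y → X₁` and along `f : Y → X₂`. -/
def CompatibleConnections [IsPseudoBundle V₁] [IsPseudoBundle V₂]
    (D₁ : Connection V₁) (D₂ : Connection V₂) : Prop :=
  ∀ (s₁ : SmoothSection V₁) (s₂ : SmoothSection V₂), G.CompatibleSections s₁ s₂ → ∀ y : G.Y,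
    TensorProduct.map (pullbackLambda (Subtype.val : G.Y → X₁) G.inclusion_smooth y y.1 rfl)
        (G.lift y).toLinearMap (D₁.toFun s₁ y.1) =
      TensorProduct.map (pullbackLambda G.f G.f_diffeo.2.1 y (G.f y) rfl)
        LinearMap.id (D₂.toFun s₂ (G.f y))

/-- A linear left inverse of an injective linear map `T`; on the range of `T` it is the inverse
of `T`. -/
def leftInverse {E : Type u} {E' : Type v} [AddCommGroup E] [Module ℝ E] [AddCommGroup E']
    [Module ℝ E'] (T : E →ₗ[ℝ] E') (hT : LinearMap.ker T = ⊥) : E' →ₗ[ℝ] E :=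
  (LinearMap.exists_leftInverse_of_injective T hT).choose

theorem leftInverse_comp {E : Type u} {E' : Type v} [AddCommGroup E] [Module ℝ E]
    [AddCommGroup E'] [Module ℝ E'] (T : E →ₗ[ℝ] E') (hT : LinearMap.ker T = ⊥) :
    leftInverse T hT ∘ₗ T = LinearMap.id :=
  (LinearMap.exists_leftInverse_of_injective T hT).choose_spec

/-- The map `f̃` on the fibre over `y`, with values in the fibre over `b = f(y)`. -/
def liftTo (y : G.Y) (b : X₂) (hb : G.f y = b) : V₁.Fiber y.1 →ₗ[ℝ] V₂.Fiber b :=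
  hb ▸ (G.lift y).toLinearMap

/-- `ρ̃₁⁻¹ ⊗ Id` over a point of `X₁ ∖ Y`. -/
def leftValue (x : X₁) (h : x ∉ G.Y) (τ₁ : (lambdaOne X₁).Fiber x ⊗[ℝ] V₁.Fiber x) :
    (lambdaOne G.Base).Fiber (.left x h) ⊗[ℝ] V₁.Fiber x :=
  TensorProduct.map (leftInverse _ (Glue.ker_rho₁ (f := G.f) x h)) LinearMap.id τ₁

/-- `ρ̃₂⁻¹ ⊗ Id` over a point of `X₂ ∖ f(Y)`. -/
def rightValue (b : X₂) (h : b ∉ Set.range G.f) (τ₂ : (lambdaOne X₂).Fiber b ⊗[ℝ] V₂.Fiber b) :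
    (lambdaOne G.Base).Fiber (.right b) ⊗[ℝ] V₂.Fiber b :=
  TensorProduct.map (leftInverse _ (Glue.ker_rho₂ (Y := G.Y) b h)) LinearMap.id τ₂

/-- `((ρ̃₁ ⊕ ρ̃₂)⁻¹ ⊗ Id)((Id ⊗ f̃)(τ₁) ⊕ τ₂)` over a point `b = f(y)`. -/
def overlapValue (y : G.Y) (b : X₂) (hb : G.f y = b)
    (τ₁ : (lambdaOne X₁).Fiber y.1 ⊗[ℝ] V₁.Fiber y.1)
    (τ₂ : (lambdaOne X₂).Fiber b ⊗[ℝ] V₂.Fiber b) :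
    (lambdaOne G.Base).Fiber (.right b) ⊗[ℝ] V₂.Fiber b :=
  TensorProduct.map (leftInverse _ (Glue.ker_rho_prod G.f_diffeo.1 y b hb)) LinearMap.id
    (TensorProduct.map (LinearMap.inl ℝ _ _) (G.liftTo y b hb) τ₁ +
      TensorProduct.map (LinearMap.inr ℝ _ _) LinearMap.id τ₂)

/-- `leftValue` is the preimage under `ρ̃₁ ⊗ Id`. -/
theorem leftValue_eq (x : X₁) (h : x ∉ G.Y)
    (τ : (lambdaOne G.Base).Fiber (.left x h) ⊗[ℝ] V₁.Fiber x) :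
    G.leftValue x h (TensorProduct.map
      (Glue.rho₁ x (.left x h) (Glue.inc₁_of_notMem h)) LinearMap.id τ) = τ := by
  rw [leftValue, ← LinearMap.comp_apply, ← TensorProduct.map_comp, leftInverse_comp]
  simp

/-- `rightValue` is the preimage under `ρ̃₂ ⊗ Id`. -/
theorem rightValue_eq (b : X₂) (h : b ∉ Set.range G.f)
    (τ : (lambdaOne G.Base).Fiber (.right b) ⊗[ℝ] V₂.Fiber b) :
    G.rightValue b h (TensorProduct.map (Glue.rho₂ b) LinearMap.id τ) = τ := by
  rw [rightValue, ← LinearMap.comp_apply, ← TensorProduct.map_comp, leftInverse_comp]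
  simp

/-- `overlapValue` is the preimage under `(ρ̃₁ ⊕ ρ̃₂) ⊗ Id`, whenever there is one. -/
theorem overlapValue_eq (y : G.Y)
    (τ : (lambdaOne G.Base).Fiber (.right (G.f y)) ⊗[ℝ] V₂.Fiber (G.f y))
    (τ₁ : (lambdaOne X₁).Fiber y.1 ⊗[ℝ] V₁.Fiber y.1)
    (hτ₁ : TensorProduct.map (Glue.rho₁ y.1 (.right (G.f y)) (Glue.inc₁_of_mem y.2)) LinearMap.id
      τ = TensorProduct.map LinearMap.id (G.lift y).toLinearMap τ₁) :
    G.overlapValue y (G.f y) rfl τ₁ (TensorProduct.map (Glue.rho₂ (G.f y)) LinearMap.id τ) =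
      τ := by
  have h1 : TensorProduct.map (LinearMap.inl ℝ ((lambdaOne X₁).Fiber y.1)
        ((lambdaOne X₂).Fiber (G.f y))) (G.liftTo y _ rfl) τ₁ =
      TensorProduct.map (LinearMap.inl ℝ _ _) LinearMap.id
        (TensorProduct.map LinearMap.id (G.lift y).toLinearMap τ₁) := by
    rw [← LinearMap.comp_apply, ← TensorProduct.map_comp]
    rfl
  rw [overlapValue, h1, ← hτ₁, ← LinearMap.comp_apply, ← LinearMap.comp_apply,
    ← TensorProduct.map_comp, ← TensorProduct.map_comp, ← LinearMap.add_apply,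
    LinearMap.id_comp, ← TensorProduct.map_add_left, ← LinearMap.comp_apply,
    ← TensorProduct.map_comp]
  have h2 : (LinearMap.inl ℝ _ _ ∘ₗ
        Glue.rho₁ y.1 (.right (G.f y)) (Glue.inc₁_of_mem y.2) +
      LinearMap.inr ℝ _ _ ∘ₗ Glue.rho₂ (G.f y)) =
      (Glue.rho₁ y.1 (.right (G.f y)) (Glue.inc₁_of_mem y.2)).prod
        (Glue.rho₂ (Y := G.Y) (f := G.f) (G.f y)) := by
    ext m <;> simp
  rw [h2, leftInverse_comp]
  simp

open Classical in
/-- The induced operator `∇^∪` on `s = s₁ ∪ s₂`. It is `(ρ̃₁⁻¹ ⊗ Id)(∇¹ s₁)` over `X₁ ∖ Y`,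
`((ρ̃₁ ⊕ ρ̃₂)⁻¹ ⊗ Id)((Id ⊗ f̃)(∇¹ s₁) ⊕ ∇² s₂)` over `f(Y)`, and `(ρ̃₂⁻¹ ⊗ Id)(∇² s₂)` over
`X₂ ∖ f(Y)`. The inverses of the injective maps `ρ̃₁`, `ρ̃₁ ⊕ ρ̃₂`, `ρ̃₂` are extended linearly
beyond their ranges. -/
def inducedConnection [IsPseudoBundle V₁] [IsPseudoBundle V₂]
    (D₁ : Connection V₁) (D₂ : Connection V₂) (s : SmoothSection G.glued) :
    ∀ x, ((lambdaOne G.Base).tensor G.glued).Fiber x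
  | .left x h => G.leftValue x h (D₁.toFun (G.restrict₁ s) x)
  | .right b =>
      if h : b ∈ Set.range G.f then
        G.overlapValue h.choose b h.choose_spec (D₁.toFun (G.restrict₁ s) h.choose.1)
          (D₂.toFun (G.restrict₂ s) b)
      else G.rightValue b h (D₂.toFun (G.restrict₂ s) b)

end BundleGluing

end BundleGluing

end

end DiffConn

/-!
The two summands `g̃(∇^∪ s, t)` and `g̃(s, ∇^∪ t)` are contractions of the `V`-factor, while
`∇^∪` is obtained from `∇¹`, `∇²` by applying a linear map `L` to the `Λ¹`-factor: over each point
`L` is a left inverse of the map `ρ` which pulls covectors of `X₁ ∪_f X₂` back to `X₁`, to `X₂`, or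
to both. The two operations commute (`contract_map`). Hence the right hand side is `L` applied to
the corresponding expression for `∇¹` and/or `∇²`, which is `d(g₁(s₁, t₁))` and/or `d(g₂(s₂, t₂))`
by compatibility of `∇ⁱ` with `gᵢ`.

The function `h = g̃(s, t)` restricts to `gᵢ(sᵢ, tᵢ)` along the canonical maps, over `Y` because
`f̃` is an isometry. So it is smooth (`Glue.dSmooth_of_comp_inc`), and since the differential
commutes with pullbacks (`pullbackLambda_d_at`), the above expression is `ρ(dh)`. Finally
`L(ρ(dh)) = dh`. As `L` is only evaluated on the range of `ρ` in the end, the choice of the left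
inverse does not matter, although it may matter for the individual summands.
-/

namespace DiffConn

universe w₁ w₂ w₃ w₄

/-! ### Contractions and differentials -/

/-- Contraction of the second factor commutes with linear maps on the first factor. -/
theorem contract_map {L : Type w₁} {L' : Type w₂} {E : Type w₃} {E' : Type w₄}
    [AddCommGroup L] [Module ℝ L] [AddCommGroup L'] [Module ℝ L'] [AddCommGroup E] [Module ℝ E]
    [AddCommGroup E'] [Module ℝ E'] (T : L →ₗ[ℝ] L') (A : E →ₗ[ℝ] E') (φ : E' →ₗ[ℝ] ℝ)
    (τ : L ⊗[ℝ] E) :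
    contract φ (TensorProduct.map T A τ) = T (contract (φ ∘ₗ A) τ) := by
  induction τ with
  | zero => simp
  | tmul a b => simp [contract]
  | add a b ha hb => simp only [map_add, ha, hb]

/-- The composite of a smooth function with a smooth map. -/
def SmoothFun.comp {A : Type u₁} {B : Type u₂} [DiffeologicalSpace A] [DiffeologicalSpace B]
    (h : SmoothFun B) (φ : A → B) (hφ : DSmooth φ) : SmoothFun A :=
  ⟨fun a => h (φ a), fun n p hp => h.2 n (φ ∘ p) (hφ n p hp)⟩

theorem pullbackLambda_d_at {A : Type u₁} {B : Type u₂} [DiffeologicalSpace A]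
    [DiffeologicalSpace B] (φ : A → B) (hφ : DSmooth φ) (a : A) (b : B) (hab : φ a = b)
    (h : SmoothFun B) :
    pullbackLambda φ hφ a b hab (h.d.at b) = (h.comp φ hφ).d.at a := rfl

/-! ### Smooth functions on a glued space -/

theorem Glue.dSmooth_of_comp_inc {X₁ : Type u₁} {X₂ : Type u₂} [DiffeologicalSpace X₁]
    [DiffeologicalSpace X₂] {Y : Set X₁} {f : Y → X₂} {A : Type w} [DiffeologicalSpace A]
    {h : Glue Y f → A} (h₁ : DSmooth (h ∘ Glue.inc₁ Y f)) (h₂ : DSmooth (h ∘ Glue.inc₂ Y f)) :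
    DSmooth h := by
  intro n q hq
  refine DiffeologicalSpace.locality fun x => ?_
  obtain ⟨s, hs, hx, ⟨p, hp, e⟩ | ⟨p, hp, e⟩⟩ := Glue.isPlot_local hq x
  · refine ⟨s, hs, hx, fun {m F} hF hF' => ?_⟩
    have : (h ∘ q) ∘ F = (h ∘ Glue.inc₁ Y f) ∘ (p ∘ F) :=
      funext fun z => congrArg h (e _ (hF z))
    rw [this]
    exact h₁ _ _ (isPlot_reparam hp hF')
  · refine ⟨s, hs, hx, fun {m F} hF hF' => ?_⟩
    have : (h ∘ q) ∘ F = (h ∘ Glue.inc₂ Y f) ∘ (p ∘ F) :=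
      funext fun z => congrArg h (e _ (hF z))
    rw [this]
    exact h₂ _ _ (isPlot_reparam hp hF')

/-! ### The induced metric and the induced connection -/

namespace BundleGluing

variable {X₁ : Type u₁} {X₂ : Type u₂} [DiffeologicalSpace X₁] [DiffeologicalSpace X₂]
  {V₁ : VectorFamily.{u₁, v} X₁} {V₂ : VectorFamily.{u₂, v} X₂} (G : BundleGluing V₁ V₂)

theorem inducedMetric_inc₁ {g₁ : ∀ x, LinearMap.BilinForm ℝ (V₁.Fiber x)}
    {g₂ : ∀ x, LinearMap.BilinForm ℝ (V₂.Fiber x)} (hg : G.CompatibleMetrics g₁ g₂)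
    (s t : SmoothSection G.glued) (x : X₁) :
    G.inducedMetric g₁ g₂ (Glue.inc₁ G.Y G.f x) (s (Glue.inc₁ G.Y G.f x))
      (t (Glue.inc₁ G.Y G.f x)) = g₁ x (G.restrict₁ s x) (G.restrict₁ t x) := by
  by_cases hx : x ∈ G.Y
  · rw [hg ⟨x, hx⟩, G.compatible_restrict s ⟨x, hx⟩, G.compatible_restrict t ⟨x, hx⟩,
      Glue.inc₁_of_mem hx]
    rfl
  · have hs : G.restrict₁ s x = s.toFun (.left x hx) := G.restrictFun_of_notMem s.toFun hx
    have ht : G.restrict₁ t x = t.toFun (.left x hx) := G.restrictFun_of_notMem t.toFun hx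
    rw [Glue.inc₁_of_notMem hx, hs, ht]
    rfl

theorem leftInverse_apply {E : Type w₁} {E' : Type w₂} [AddCommGroup E] [Module ℝ E]
    [AddCommGroup E'] [Module ℝ E'] (T : E →ₗ[ℝ] E') (hT : LinearMap.ker T = ⊥) (m : E) :
    leftInverse T hT (T m) = m :=
  LinearMap.congr_fun (leftInverse_comp T hT) m

theorem contract_leftValue (x : X₁) (h : x ∉ G.Y) (φ : V₁.Fiber x →ₗ[ℝ] ℝ)
    (τ : (lambdaOne X₁).Fiber x ⊗[ℝ] V₁.Fiber x) :
    contract φ (G.leftValue x h τ) =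
      leftInverse _ (Glue.ker_rho₁ (f := G.f) x h) (contract φ τ) :=
  contract_map _ LinearMap.id φ τ

theorem contract_rightValue (b : X₂) (h : b ∉ Set.range G.f) (φ : V₂.Fiber b →ₗ[ℝ] ℝ)
    (τ : (lambdaOne X₂).Fiber b ⊗[ℝ] V₂.Fiber b) :
    contract φ (G.rightValue b h τ) =
      leftInverse _ (Glue.ker_rho₂ (Y := G.Y) b h) (contract φ τ) :=
  contract_map _ LinearMap.id φ τ

theorem contract_overlapValue (y : G.Y) (b : X₂) (hb : G.f y = b) (φ : V₂.Fiber b →ₗ[ℝ] ℝ)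
    (τ₁ : (lambdaOne X₁).Fiber y.1 ⊗[ℝ] V₁.Fiber y.1)
    (τ₂ : (lambdaOne X₂).Fiber b ⊗[ℝ] V₂.Fiber b) :
    contract φ (G.overlapValue y b hb τ₁ τ₂) =
      leftInverse _ (Glue.ker_rho_prod G.f_diffeo.1 y b hb)
        (contract (φ ∘ₗ G.liftTo y b hb) τ₁, contract φ τ₂) := by
  rw [overlapValue, contract_map, LinearMap.comp_id, map_add, contract_map, contract_map,
    LinearMap.comp_id]
  simp

/-- Over a point of `f(Y)` the functional `g₂(s₂, ·)`, pulled back along `f̃`, is `g₁(s₁, ·)`. -/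
theorem metric_comp_liftTo {g₁ : ∀ x, LinearMap.BilinForm ℝ (V₁.Fiber x)}
    {g₂ : ∀ x, LinearMap.BilinForm ℝ (V₂.Fiber x)} (hg : G.CompatibleMetrics g₁ g₂)
    {s₁ : SmoothSection V₁} {s₂ : SmoothSection V₂} (hs : G.CompatibleSections s₁ s₂)
    (y : G.Y) (b : X₂) (hb : G.f y = b) :
    g₂ b (s₂ b) ∘ₗ G.liftTo y b hb = g₁ y.1 (s₁ y.1) := by
  subst hb
  ext a
  rw [hg y, hs y]
  rfl

theorem metric_flip_comp_liftTo {g₁ : ∀ x, LinearMap.BilinForm ℝ (V₁.Fiber x)}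
    {g₂ : ∀ x, LinearMap.BilinForm ℝ (V₂.Fiber x)} (hg : G.CompatibleMetrics g₁ g₂)
    {t₁ : SmoothSection V₁} {t₂ : SmoothSection V₂} (ht : G.CompatibleSections t₁ t₂)
    (y : G.Y) (b : X₂) (hb : G.f y = b) :
    (g₂ b).flip (t₂ b) ∘ₗ G.liftTo y b hb = (g₁ y.1).flip (t₁ y.1) := by
  subst hb
  ext a
  change _ = g₁ y.1 a (t₁ y.1)
  rw [hg y, ht y]
  rfl

end BundleGluing

end DiffConn

theorem mainTheorem3 {X₁ : Type u₁} {X₂ : Type u₂}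
    [DiffeologicalSpace X₁] [DiffeologicalSpace X₂]
    (V₁ : DiffConn.VectorFamily.{u₁, v} X₁) (V₂ : DiffConn.VectorFamily.{u₂, v} X₂)
    [DiffConn.IsPseudoBundle V₁] [DiffConn.IsPseudoBundle V₂]
    [∀ x, FiniteDimensional ℝ (V₁.Fiber x)] [∀ x, FiniteDimensional ℝ (V₂.Fiber x)]
    (G : DiffConn.BundleGluing V₁ V₂) (hG : G.ExtendibilityCondition)
    (D₁ : DiffConn.Connection V₁) (D₂ : DiffConn.Connection V₂)
    (hD : G.CompatibleConnections D₁ D₂)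
    (g₁ : ∀ x, LinearMap.BilinForm ℝ (V₁.Fiber x)) (g₂ : ∀ x, LinearMap.BilinForm ℝ (V₂.Fiber x))
    (hg₁ : DiffConn.IsPseudoMetric V₁ g₁) (hg₂ : DiffConn.IsPseudoMetric V₂ g₂)
    (hg : G.CompatibleMetrics g₁ g₂)
    (hDg₁ : DiffConn.MetricCompatible V₁ (fun s x => D₁.toFun s x) g₁)
    (hDg₂ : DiffConn.MetricCompatible V₂ (fun s x => D₂.toFun s x) g₂) :
    DiffConn.MetricCompatible G.glued (G.inducedConnection D₁ D₂) (G.inducedMetric g₁ g₂) := by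
  intro s t
  obtain ⟨h₁, hh₁, dh₁⟩ := hDg₁ (G.restrict₁ s) (G.restrict₁ t)
  obtain ⟨h₂, hh₂, dh₂⟩ := hDg₂ (G.restrict₂ s) (G.restrict₂ t)
  let k : G.Base → ℝ := fun x => G.inducedMetric g₁ g₂ x (s x) (t x)
  have k₁ : k ∘ DiffConn.Glue.inc₁ G.Y G.f = h₁.1 :=
    funext fun x => (G.inducedMetric_inc₁ hg s t x).trans (hh₁ x).symm
  have k₂ : k ∘ DiffConn.Glue.inc₂ G.Y G.f = h₂.1 := funext fun x => (hh₂ x).symm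
  let h : DiffConn.SmoothFun G.Base :=
    ⟨k, DiffConn.Glue.dSmooth_of_comp_inc (k₁ ▸ h₁.2) (k₂ ▸ h₂.2)⟩
  have e₁ : h.comp _ DiffConn.Glue.inc₁_smooth = h₁ := Subtype.ext k₁
  have e₂ : h.comp _ DiffConn.Glue.inc₂_smooth = h₂ := Subtype.ext k₂
  have ρ₁ : ∀ a x (hx : DiffConn.Glue.inc₁ G.Y G.f a = x),
      DiffConn.Glue.rho₁ a x hx (h.d.at x) = h₁.d.at a := fun a x hx =>
    e₁ ▸ DiffConn.pullbackLambda_d_at _ _ a x hx h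
  have ρ₂ : ∀ b, DiffConn.Glue.rho₂ b (h.d.at (.right b)) = h₂.d.at b := fun b =>
    e₂ ▸ DiffConn.pullbackLambda_d_at _ _ b _ rfl h
  refine ⟨h, fun _ => rfl, ?_⟩
  -- In each case `dh` is written as `L (ρ (dh))`, and `ρ (dh)` is computed on `X₁` and `X₂`.
  rintro (⟨x, hx⟩ | b)
  · have hs : G.restrict₁ s x = s.toFun (.left x hx) := G.restrictFun_of_notMem s.toFun hx
    have ht : G.restrict₁ t x = t.toFun (.left x hx) := G.restrictFun_of_notMem t.toFun hx
    have d := dh₁ x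
    rw [hs, ht] at d
    refine (DiffConn.BundleGluing.leftInverse_apply _ (DiffConn.Glue.ker_rho₁ x hx) _).symm.trans ?_
    rw [ρ₁, d, map_add]
    exact (congrArg₂ (· + ·) (G.contract_leftValue x hx _ _) (G.contract_leftValue x hx _ _)).symm
  · by_cases hb : b ∈ Set.range G.f
    · have hD (u : DiffConn.SmoothSection G.glued) : G.inducedConnection D₁ D₂ u (.right b) =
          G.overlapValue hb.choose b hb.choose_spec (D₁.toFun (G.restrict₁ u) hb.choose.1)
            (D₂.toFun (G.restrict₂ u) b) := dif_pos hb
      refine (DiffConn.BundleGluing.leftInverse_apply _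
        (DiffConn.Glue.ker_rho_prod G.f_diffeo.1 hb.choose b hb.choose_spec) _).symm.trans ?_
      refine (congrArg _ (Prod.ext (ρ₁ _ _ _) (ρ₂ b) :
        _ = (h₁.d.at hb.choose.1, h₂.d.at b))).trans ?_
      rw [dh₁, dh₂, ← Prod.mk_add_mk, map_add,
        ← G.metric_comp_liftTo hg (G.compatible_restrict s) hb.choose b hb.choose_spec,
        ← G.metric_flip_comp_liftTo hg (G.compatible_restrict t) hb.choose b hb.choose_spec,
        hD, hD]
      exact (congrArg₂ (· + ·) (G.contract_overlapValue _ b _ _ _ _)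
        (G.contract_overlapValue _ b _ _ _ _)).symm
    · have hD (u : DiffConn.SmoothSection G.glued) : G.inducedConnection D₁ D₂ u (.right b) =
          G.rightValue b hb (D₂.toFun (G.restrict₂ u) b) := dif_neg hb
      refine (DiffConn.BundleGluing.leftInverse_apply _
        (DiffConn.Glue.ker_rho₂ b hb) _).symm.trans ?_
      rw [ρ₂, dh₂, map_add, hD, hD]
      exact (congrArg₂ (· + ·) (G.contract_rightValue b hb _ _)
        (G.contract_rightValue b hb _ _)).symm
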